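/- \textbf{Setting.} Let $X$ be an infinite set of atoms and $X'$ a set of atoms (atoms have no elements inside the superstructures and differ from all sets in them). The superstructure over $X$ is $\mathbb{V}(X)=\bigcup_{n}V_n(X)$, where $V_0(X)=X$ and $V_{n+1}(X)=V_n(X)\cup\wp(V_n(X))$. Formulas are first order formulas with bounded quantifiers in the language of $\mathbb{V}(X)$: terms are built from variables and constants for the elements of $\mathbb{V}(X)$ by forming ordered pairs $(s,t)$ and function values $s(t)$; atomic formulas are $s=t$ and $s\in t$ (false if they contain an undefined term $s(t)$); all quantifiers have the form $\exists x\in t$ or $\forall x\in t$. A formula is totally open if it has no quantifiers. Let $*:\mathbb{V}(X)\to\mathbb{V}(X')$ satisfy the transfer principle: a sentence $\psi$ is true in $\mathbb{V}(X)$ if and only if the sentence $^*\psi$, obtained by replacing every constant $c$ by $^*c$, is true in $\mathbb{V}(X')$. (The case $X'=X$ is allowed.) Let $Y\in\mathbb{V}(X)$ be a set, and assume that $*$ has the $|\wp(Y)|^{+}$-enlarging property: for every family $\mathcal{F}$ of fewer than $|\wp(Y)|^{+}$ sets of $\mathbb{V}(X)$ with the finite intersection property, $\bigcap_{A\in\mathcal{F}}{}^*A\neq\emptyset$.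 For $\alpha,\beta\in{}^*Y$ write $\alpha\sim_Y\beta$ if $\{A\subseteq Y\mid \alpha\in{}^*A\}=\{A\subseteq Y\mid\beta\in{}^*A\}$. Let $n\ge 1$, $m\ge 0$, let $\varphi(x_1,\dots,x_n,y_1,\dots,y_m)$ be a totally open formula, let $S_1,\dots,S_m\in\mathbb{V}(X)$ be sets and let $Q_1,\dots,Q_m\in\{\exists,\forall\}$. Let $E$ be the existential closure $\exists x_1\dots\exists x_n\,Q_1y_1\in S_1\dots Q_my_m\in S_m\ \varphi$. A set $A\subseteq Y$ models $E$, written $A\models E$, if $$\exists x_1\in A\dots\exists x_n\in A\ Q_1y_1\in S_1\dots Q_my_m\in S_m\ \varphi(x_1,\dots,x_n,y_1,\dots,y_m)$$ is true. The formula $E$ is partition regular on $Y$ if for every $k\in\mathbb{N}$ and every partition $Y=A_1\cup\dots\cup A_k$ into pairwise disjoint (possibly empty) sets there is $i\le k$ with $A_i\models E$. \textbf{Theorem.} The following are equivalent: \begin{enumerate} \item $E$ is partition regular on $Y$; \item there are $\alpha_1,\dots,\alpha_n\in{}^*Y$ with $\alpha_1\sim_Y\dots\sim_Y\alpha_n$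 such that $Q_1y_1\in{}^*S_1\dots Q_my_m\in{}^*S_m\ {}^*\varphi(\alpha_1,\dots,\alpha_n,y_1,\dots,y_m)$ is true; \item there is an ultrafilter $\mathcal{U}$ on $Y$ such that $A\models E$ for every $A\in\mathcal{U}$. \end{enumerate} -/

import Mathlib

open Cardinal

universe u v w

namespace Nonstandard

/-! ### Superstructures -/

/-- The levels of the cumulative hierarchy over `X`:
`V₀(X) = X` and `Vₙ₊₁(X) = Vₙ(X) ∪ ℘(Vₙ(X))`. -/
noncomputable def level (X : ZFSet.{u}) : ℕ → ZFSet.{u}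
  | 0 => X
  | n + 1 => level X n ∪ ZFSet.powerset (level X n)

/-- `X` is a base set (a set of atoms): its members are nonempty, and no member of a member of `X`
belongs to the superstructure over `X`. Thus members of `X` have no members in the superstructure
and are different from all the sets of the superstructure. -/
def IsBaseSet (X : ZFSet.{u}) : Prop :=
  ∀ x ∈ X, x ≠ ∅ ∧ ∀ z ∈ x, ∀ n, z ∉ level X n

/-- The superstructure `𝕍(X) = ⋃ₙ Vₙ(X)`. -/
def Superstructure (X : ZFSet.{u}) : Type (u + 1) :=
  {a : ZFSet.{u} // ∃ n, a ∈ level X n}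

namespace Superstructure

variable {X : ZFSet.{u}}

/-- Membership between elements of the superstructure: `a ∈ b`. -/
instance : Membership (Superstructure X) (Superstructure X) :=
  ⟨fun b a => a.1 ∈ b.1⟩

/-- An element of `𝕍(X)` is a set if it is not one of the atoms. -/
def IsSet (a : Superstructure X) : Prop := a.1 ∉ X

/-- `p` is the (Kuratowski) ordered pair `(a, b)`. -/
def IsPair (p a b : Superstructure X) : Prop := p.1 = ZFSet.pair a.1 b.1

/-- `f` is a function: a single-valued set of ordered pairs. -/
def IsFunction (f : Superstructure X) : Prop :=
  (∀ p ∈ f, ∃ a b, IsPair p a b) ∧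
    ∀ p ∈ f, ∀ q ∈ f, ∀ a b c, IsPair p a b → IsPair q a c → b = c

/-- `f` is a function, `a` is in its domain, and `f(a) = b`. -/
def IsValue (f a b : Superstructure X) : Prop :=
  IsFunction f ∧ ∃ p ∈ f, IsPair p a b

/-- `A` is a set contained in `Y`. -/
def IsSubset (A Y : Superstructure X) : Prop :=
  A.IsSet ∧ ∀ a ∈ A, a ∈ Y

/-- The type of the elements of `Y ∈ 𝕍(X)`. -/
def Elem (Y : Superstructure X) : Type (u + 1) := {y : Superstructure X // y ∈ Y}

end Superstructure

/-! ### The first order language of a superstructure, with bounded quantifiers -/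

/-- Terms with constants from `C` and variables `v₀, …, vₙ₋₁`: variables, constants,
ordered pairs `(s, t)` and function values `s(t)`. -/
inductive Term (C : Type w) (n : ℕ) : Type w
  | var (i : Fin n) : Term C n
  | const (c : C) : Term C n
  | pair (s t : Term C n) : Term C n
  | app (s t : Term C n) : Term C n

/-- The two quantifiers. -/
inductive Quantifier : Type
  | ex : Quantifier
  | all : Quantifier

/-- Formulas with constants from `C`, free variables among `v₀, …, vₙ₋₁`, and bounded quantifiers.
In `bounded Q t φ`, read `Q vₙ ∈ t, φ`, the variable `vₙ` of `φ` is bound (and `vₙ` does not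
occur in `t`). -/
inductive Formula (C : Type w) : ℕ → Type w
  | eq {n : ℕ} (s t : Term C n) : Formula C n
  | mem {n : ℕ} (s t : Term C n) : Formula C n
  | neg {n : ℕ} (φ : Formula C n) : Formula C n
  | and {n : ℕ} (φ ψ : Formula C n) : Formula C n
  | or {n : ℕ} (φ ψ : Formula C n) : Formula C n
  | imp {n : ℕ} (φ ψ : Formula C n) : Formula C n
  | bounded {n : ℕ} (Q : Quantifier) (t : Term C n) (φ : Formula C (n + 1)) : Formula C n

/-- Replace every constant `c` of a term by `f c`. -/
def Term.map {C : Type v} {D : Type w} (f : C → D) {n : ℕ} : Term C n → Term D n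
  | .var i => .var i
  | .const c => .const (f c)
  | .pair s t => .pair (s.map f) (t.map f)
  | .app s t => .app (s.map f) (t.map f)

/-- Replace every constant `c` of a formula by `f c`. If `f` is the star map, this turns `φ` into
`*φ`. -/
def Formula.map {C : Type v} {D : Type w} (f : C → D) : {n : ℕ} → Formula C n → Formula D n
  | _, .eq s t => .eq (s.map f) (t.map f)
  | _, .mem s t => .mem (s.map f) (t.map f)
  | _, .neg φ => .neg (φ.map f)
  | _, .and φ ψ => .and (φ.map f) (ψ.map f)
  | _, .or φ ψ => .or (φ.map f) (ψ.map f)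
  | _, .imp φ ψ => .imp (φ.map f) (ψ.map f)
  | _, .bounded Q t φ => .bounded Q (t.map f) (φ.map f)

/-- A formula is totally open if all its variables are free, that is, if it has no quantifiers. -/
def Formula.IsTotallyOpen {C : Type w} : {n : ℕ} → Formula C n → Prop
  | _, .eq _ _ => True
  | _, .mem _ _ => True
  | _, .neg φ => φ.IsTotallyOpen
  | _, .and φ ψ => φ.IsTotallyOpen ∧ ψ.IsTotallyOpen
  | _, .or φ ψ => φ.IsTotallyOpen ∧ ψ.IsTotallyOpen
  | _, .imp φ ψ => φ.IsTotallyOpen ∧ ψ.IsTotallyOpen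
  | _, .bounded _ _ _ => False

/-- `t.Names v a`: under the assignment `v` of the variables, the term `t` is defined and names the
element `a` of `𝕍(X)`. The term `s(t)` is undefined if `s` does not name a function which has the
element named by `t` in its domain. -/
def Term.Names {X : ZFSet.{u}} {n : ℕ} :
    Term (Superstructure X) n → (Fin n → Superstructure X) → Superstructure X → Prop
  | .var i, v, a => a = v i
  | .const c, _, a => a = c
  | .pair s t, v, a => ∃ b c, s.Names v b ∧ t.Names v c ∧ Superstructure.IsPair a b c
  | .app s t, v, a => ∃ f b, s.Names v f ∧ t.Names v b ∧ Superstructure.IsValue f b a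

/-- Truth of a formula in `𝕍(X)` under the assignment `v` of its free variables. Atomic formulas
containing undefined terms are false. -/
def Formula.Holds {X : ZFSet.{u}} :
    {n : ℕ} → Formula (Superstructure X) n → (Fin n → Superstructure X) → Prop
  | _, .eq s t, v => ∃ a, s.Names v a ∧ t.Names v a
  | _, .mem s t, v => ∃ a b, s.Names v a ∧ t.Names v b ∧ a ∈ b
  | _, .neg φ, v => ¬ φ.Holds v
  | _, .and φ ψ, v => φ.Holds v ∧ ψ.Holds v
  | _, .or φ ψ, v => φ.Holds v ∨ ψ.Holds v
  | _, .imp φ ψ, v => φ.Holds v → ψ.Holds v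
  | _, .bounded .ex t φ, v => ∃ b, t.Names v b ∧ ∃ a ∈ b, φ.Holds (Fin.snoc v a)
  | _, .bounded .all t φ, v => ∀ b, t.Names v b → ∀ a ∈ b, φ.Holds (Fin.snoc v a)

/-- Truth of a sentence in `𝕍(X)`. -/
def Formula.IsTrue {X : ZFSet.{u}} (φ : Formula (Superstructure X) 0) : Prop :=
  φ.Holds Fin.elim0

/-- For `φ(x₁, …, xₙ, y₁, …, yₘ)`, where `x₁, …, xₙ` are the variables `v₀, …, vₙ₋₁` and
`y₁, …, yₘ` are the variables `vₙ, …, vₙ₊ₘ₋₁`, this is the formula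
`Q₁ y₁ ∈ S₁ … Qₘ yₘ ∈ Sₘ, φ(x₁, …, xₙ, y₁, …, yₘ)` in the free variables `x₁, …, xₙ`. -/
def Formula.constrain {C : Type w} {n : ℕ} : {m : ℕ} →
    (Fin m → Quantifier) → (Fin m → C) → Formula C (n + m) → Formula C n
  | 0, _, _, φ => φ
  | m + 1, Q, S, φ =>
      Formula.constrain (fun i : Fin m => Q i.castSucc) (fun i : Fin m => S i.castSucc)
        (.bounded (Q (Fin.last m)) (.const (S (Fin.last m))) φ)

/-- The sentence `∃ x₁ ∈ A … ∃ xₙ ∈ A, φ(x₁, …, xₙ)`. -/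
def Formula.existsIn {C : Type w} (A : C) : {n : ℕ} → Formula C n → Formula C 0
  | 0, φ => φ
  | _ + 1, φ => Formula.existsIn A (.bounded .ex (.const A) φ)

/-! ### Partition regularity -/

section PartitionRegular

variable {X : ZFSet.{u}} {n m : ℕ}

/-- `A` models the existential closure `∃ x₁ … ∃ xₙ, Q₁ y₁ ∈ S₁ … Qₘ yₘ ∈ Sₘ, φ`, that is,
the sentence `∃ x₁ ∈ A … ∃ xₙ ∈ A, Q₁ y₁ ∈ S₁ … Qₘ yₘ ∈ Sₘ, φ` is true. -/
def ModelsExistentialClosure (A : Superstructure X) (Q : Fin m → Quantifier)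
    (S : Fin m → Superstructure X) (φ : Formula (Superstructure X) (n + m)) : Prop :=
  ((φ.constrain Q S).existsIn A).IsTrue

/-- `Y = A₁ ∪ … ∪ Aₖ` is a partition of `Y` into sets (empty pieces are allowed). -/
def IsPartition (Y : Superstructure X) {k : ℕ} (A : Fin k → Superstructure X) : Prop :=
  (∀ i, (A i).IsSubset Y) ∧ (∀ y ∈ Y, ∃ i, y ∈ A i) ∧
    ∀ i j, i ≠ j → ∀ y ∈ A i, y ∉ A j

/-- The existential closure of `φ` with the constraints `Qᵢ yᵢ ∈ Sᵢ` is partition regular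
on `Y`. -/
def IsPartitionRegular (Y : Superstructure X) (Q : Fin m → Quantifier)
    (S : Fin m → Superstructure X) (φ : Formula (Superstructure X) (n + m)) : Prop :=
  ∀ (k : ℕ) (A : Fin k → Superstructure X), IsPartition Y A →
    ∃ i, ModelsExistentialClosure (A i) Q S φ

/-- The ultrafilter `U` on `Y` contains the set `A ⊆ Y`. -/
def UltrafilterContains {Y : Superstructure X} (U : Ultrafilter Y.Elem)
    (A : Superstructure X) : Prop :=
  A.IsSubset Y ∧ {y : Y.Elem | y.1 ∈ A} ∈ U

end PartitionRegular

/-! ### Superstructure models of nonstandard methods -/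

/-- A superstructure model of nonstandard methods `⟨𝕍(X), 𝕍(X'), *⟩`: `X` is an infinite set of
atoms, `X'` is a set of atoms, and the map `* : 𝕍(X) → 𝕍(X')` satisfies the transfer principle for
all sentences with bounded quantifiers. The model is single if `X = X'`. -/
structure SuperstructureModel (X : ZFSet.{u}) (X' : ZFSet.{v}) where
  isBaseSet : IsBaseSet X
  isBaseSet' : IsBaseSet X'
  infinite : {x : ZFSet.{u} | x ∈ X}.Infinite
  star : Superstructure X → Superstructure X'
  transfer : ∀ φ : Formula (Superstructure X) 0, φ.IsTrue ↔ (φ.map star).IsTrue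

namespace SuperstructureModel

variable {X : ZFSet.{u}} {X' : ZFSet.{v}}

/-- The `κ`-enlarging property: if `F` is a family of fewer than `κ` sets of `𝕍(X)` with the finite
intersection property, then the intersection of all `*A` with `A ∈ F` is nonempty. -/
def IsEnlarging (M : SuperstructureModel X X') (κ : Cardinal.{u + 1}) : Prop :=
  ∀ F : Set (Superstructure X), (∀ A ∈ F, A.IsSet) → #F < κ →
    (∀ G : Set (Superstructure X), G ⊆ F → G.Finite → ∃ x : Superstructure X, ∀ A ∈ G, x ∈ A) →
      ∃ ξ : Superstructure X', ∀ A ∈ F, ξ ∈ M.star A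

/-- The ultrafilter `{A ⊆ Y ∣ α ∈ *A}` generated on `Y` by `α ∈ *Y`, as a family of sets. -/
def generated (M : SuperstructureModel X X') (Y : Superstructure X) (α : Superstructure X') :
    Set (Superstructure X) :=
  {A | A.IsSubset Y ∧ α ∈ M.star A}

/-- `α ∼_Y β`: the points `α` and `β` of `*Y` generate the same ultrafilter on `Y`. -/
def Equivalent (M : SuperstructureModel X X') (Y : Superstructure X)
    (α β : Superstructure X') : Prop :=
  α ∈ M.star Y ∧ β ∈ M.star Y ∧ M.generated Y α = M.generated Y β

end SuperstructureModel

end Nonstandard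

namespace Nonstandard

/-! ### Sets and pairs in a superstructure -/

section Superstructure

variable {X : ZFSet.{u}}

/-! A set is bad if it does not model `E`; subsets of bad sets are bad. Partition regularity says
that no finite partition of `Y` has only bad pieces, so the complements of bad sets have the finite
intersection property and lie in some ultrafilter, whose members all model `E`
(`IsPartitionRegular.exists_ultrafilter`). Conversely, an ultrafilter contains a piece of every
finite partition.

A point `α` of `*Y` generates an ultrafilter. If all `α i` generate the same one, then for each `A`
in it they witness `*E` inside `*A`, and transfer returns witnesses in `A`.

To pass from an ultrafilter `U` to points, code the solutions with entries in `S` as a set `B S` of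
iterated pairs, for each `S ∈ U`. These sets have the finite intersection property and number at
most `|℘(Y)|`, so enlargement gives one `ξ` in every `*(B S)`; its components generate `U` and
satisfy the transferred formula (`exists_generators`). -/

theorem level_mono (X : ZFSet.{u}) {i j : ℕ} (h : i ≤ j) : level X i ⊆ level X j := by
  induction h with
  | refl => exact fun _ hz => hz
  | step _ ih => exact fun z hz => ZFSet.mem_union.2 (Or.inl (ih hz))

theorem mem_level_of_mem {n : ℕ} {a z : ZFSet.{u}} (ha : a ∈ level X n) (haX : a ∉ X)
    (hz : z ∈ a) : z ∈ level X n := by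
  induction n with
  | zero => exact absurd ha haX
  | succ n ih =>
    refine ZFSet.mem_union.2 (Or.inl ?_)
    rcases ZFSet.mem_union.1 ha with h | h
    · exact ih h
    · exact ZFSet.mem_powerset.1 h hz

theorem mem_level_succ_of_subset {n : ℕ} {a : ZFSet.{u}} (h : a ⊆ level X n) :
    a ∈ level X (n + 1) :=
  ZFSet.mem_union.2 (Or.inr (ZFSet.mem_powerset.2 h))

theorem pair_mem_level {n : ℕ} {a b : ZFSet.{u}} (ha : a ∈ level X n) (hb : b ∈ level X n) :
    ZFSet.pair a b ∈ level X (n + 2) := by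
  refine mem_level_succ_of_subset fun z hz => ?_
  rcases ZFSet.mem_pair.1 hz with rfl | rfl <;> refine mem_level_succ_of_subset fun w hw => ?_
  · rwa [ZFSet.mem_singleton.1 hw]
  · rcases ZFSet.mem_pair.1 hw with rfl | rfl <;> assumption

theorem IsBaseSet.isSet_of_mem (hX : IsBaseSet X) {a z : Superstructure X} (hz : z ∈ a) :
    a.IsSet := fun ha => z.2.elim fun n hn => (hX _ ha).2 _ hz n hn

/-- Comprehension inside a level of the superstructure. -/
theorem IsBaseSet.exists_isSet (hX : IsBaseSet X) (n : ℕ) (p : Superstructure X → Prop) :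
    ∃ A : Superstructure X, A.IsSet ∧ ∀ y : Superstructure X, y ∈ A ↔ y.1 ∈ level X n ∧ p y := by
  have key : ∀ z, z ∈ ZFSet.sep (fun z => ∃ y : Superstructure X, y.1 = z ∧ p y) (level X n) ↔
      z ∈ level X n ∧ ∃ y : Superstructure X, y.1 = z ∧ p y := fun z => ZFSet.mem_sep
  refine ⟨⟨ZFSet.sep (fun z => ∃ y : Superstructure X, y.1 = z ∧ p y) (level X n), n + 1,
    mem_level_succ_of_subset fun z hz => ((key z).1 hz).1⟩, fun hA => ?_, fun y => ?_⟩
  -- An atom is nonempty with members outside every level, whereas the separated set has all its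
  -- members in level `n`.
  · obtain ⟨z, hz⟩ := (ZFSet.eq_empty_or_nonempty _).resolve_left (hX _ hA).1
    exact (hX _ hA).2 z hz n ((key z).1 hz).1
  · refine (key y.1).trans (and_congr_right fun _ => ⟨?_, fun h => ⟨y, rfl, h⟩⟩)
    rintro ⟨y', h, hp⟩
    rwa [← Subtype.ext h]

theorem IsBaseSet.exists_level_of_mem (hX : IsBaseSet X) (Y : Superstructure X) :
    ∃ n, ∀ y : Superstructure X, y ∈ Y → y.1 ∈ level X n := by
  obtain ⟨n, hn⟩ := Y.2
  exact ⟨n, fun y hy => mem_level_of_mem hn (hX.isSet_of_mem hy) hy⟩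

theorem IsBaseSet.exists_isSubset (hX : IsBaseSet X) (Y : Superstructure X) (S : Set Y.Elem) :
    ∃ A : Superstructure X, A.IsSubset Y ∧ ∀ y : Y.Elem, y.1 ∈ A ↔ y ∈ S := by
  obtain ⟨n, hn⟩ := hX.exists_level_of_mem Y
  obtain ⟨A, hA, hmem⟩ := hX.exists_isSet n fun y => ∃ h : y ∈ Y, (⟨y, h⟩ : Y.Elem) ∈ S
  exact ⟨A, ⟨hA, fun a ha => ((hmem a).1 ha).2.1⟩, fun y => (hmem y.1).trans
    ⟨fun h => h.2.2, fun h => ⟨hn _ y.2, y.2, h⟩⟩⟩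

/-- The element of `𝕍(X)` corresponding to a set of members of `Y`. -/
noncomputable def IsBaseSet.subset (hX : IsBaseSet X) {Y : Superstructure X} (S : Set Y.Elem) :
    Superstructure X := (hX.exists_isSubset Y S).choose

theorem IsBaseSet.subset_isSubset (hX : IsBaseSet X) {Y : Superstructure X} (S : Set Y.Elem) :
    (hX.subset S).IsSubset Y := (hX.exists_isSubset Y S).choose_spec.1

theorem IsBaseSet.mem_subset (hX : IsBaseSet X) {Y : Superstructure X} {S : Set Y.Elem}
    (y : Y.Elem) : y.1 ∈ hX.subset S ↔ y ∈ S := (hX.exists_isSubset Y S).choose_spec.2 y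

theorem IsBaseSet.mem_subset_iff (hX : IsBaseSet X) {Y : Superstructure X} {S : Set Y.Elem}
    {y : Superstructure X} : y ∈ hX.subset S ↔ ∃ h : y ∈ Y, (⟨y, h⟩ : Y.Elem) ∈ S :=
  ⟨fun h => ⟨(hX.subset_isSubset S).2 y h, (hX.mem_subset ⟨y, _⟩).1 h⟩,
    fun ⟨h, hS⟩ => (hX.mem_subset ⟨y, h⟩).2 hS⟩

theorem IsBaseSet.ultrafilterContains_subset (hX : IsBaseSet X) {Y : Superstructure X}
    {U : Ultrafilter Y.Elem} {S : Set Y.Elem} (hS : S ∈ U) :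
    UltrafilterContains U (hX.subset S) :=
  ⟨hX.subset_isSubset S, Filter.mem_of_superset hS fun y hy => (hX.mem_subset y).2 hy⟩

theorem Superstructure.IsPair.inj {p a b a' b' : Superstructure X} (h : IsPair p a b)
    (h' : IsPair p a' b') : a = a' ∧ b = b' := by
  obtain ⟨h₁, h₂⟩ := ZFSet.pair_inj.1 (h.symm.trans h')
  exact ⟨Subtype.ext h₁, Subtype.ext h₂⟩

/-- `a` is the iterated ordered pair `(…((c, x₀), x₁), …, xₙ₋₁)`. -/
def IsTuple (c : Superstructure X) : {n : ℕ} → (Fin n → Superstructure X) →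
    Superstructure X → Prop
  | 0, _, a => a = c
  | _ + 1, x, a => ∃ b, IsTuple c (fun i => x i.castSucc) b ∧
      Superstructure.IsPair a b (x (Fin.last _))

/-- Used on the star side: a single `ξ` read as a tuple in several ways has the same components each
time. -/
theorem IsTuple.inj {c : Superstructure X} {n : ℕ} {x x' : Fin n → Superstructure X}
    {a : Superstructure X} (h : IsTuple c x a) (h' : IsTuple c x' a) : x = x' := by
  induction n generalizing a with
  | zero => exact Subsingleton.elim _ _
  | succ n ih =>
    obtain ⟨b, hb, hp⟩ := h
    obtain ⟨b', hb', hp'⟩ := h'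
    obtain ⟨rfl, hl⟩ := hp.inj hp'
    have := ih hb hb'
    funext i
    refine Fin.lastCases hl (fun j => congrFun this j) i

/-- The bound `K` does not depend on `x`, so all the codes can be collected into one set by
comprehension in level `K`. -/
theorem exists_isTuple (c : Superstructure X) (N n : ℕ) : ∃ K, ∀ x : Fin n → Superstructure X,
    (∀ i, (x i).1 ∈ level X N) → ∃ a, IsTuple c x a ∧ a.1 ∈ level X K := by
  induction n with
  | zero =>
    obtain ⟨k, hk⟩ := c.2
    exact ⟨k, fun _ _ => ⟨c, rfl, hk⟩⟩
  | succ n ih =>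
    obtain ⟨K, hK⟩ := ih
    refine ⟨max K N + 2, fun x hx => ?_⟩
    obtain ⟨b, hb, hbK⟩ := hK _ fun i => hx i.castSucc
    have hp := pair_mem_level (level_mono X (le_max_left K N) hbK)
      (level_mono X (le_max_right K N) (hx (Fin.last n)))
    exact ⟨⟨_, _, hp⟩, ⟨b, hb, rfl⟩, hp⟩

end Superstructure

/-! ### Iterated bounded quantifiers -/

section Formulas

theorem Formula.map_constrain {C : Type v} {D : Type w} (f : C → D) {n m : ℕ}
    (Q : Fin m → Quantifier) (S : Fin m → C) (φ : Formula C (n + m)) :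
    (φ.constrain Q S).map f = (φ.map f).constrain Q (fun i => f (S i)) := by
  induction m with
  | zero => rfl
  | succ m ih => exact ih _ _ _

theorem Formula.map_existsIn {C : Type v} {D : Type w} (f : C → D) {n : ℕ} (A : C)
    (φ : Formula C n) : (φ.existsIn A).map f = (φ.map f).existsIn (f A) := by
  induction n with
  | zero => rfl
  | succ n ih => exact ih _

/-- The term `(…((c, x₀), x₁), …, xⱼ₋₁)`. -/
def Term.tuple {C : Type w} {k : ℕ} (c : C) : {j : ℕ} → (Fin j → Fin k) → Term C k
  | 0, _ => .const c
  | _ + 1, x => .pair (Term.tuple c fun i => x i.castSucc) (.var (x (Fin.last _)))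

theorem Term.map_tuple {C : Type v} {D : Type w} (f : C → D) {k j : ℕ} (c : C)
    (x : Fin j → Fin k) : (Term.tuple c x).map f = Term.tuple (f c) x := by
  induction j with
  | zero => rfl
  | succ j ih => simp only [Term.tuple, Term.map, ih]

variable {X : ZFSet.{u}}

theorem Term.names_tuple {k j : ℕ} (c : Superstructure X) (x : Fin j → Fin k)
    (v : Fin k → Superstructure X) (a : Superstructure X) :
    (Term.tuple c x).Names v a ↔ IsTuple c (fun i => v (x i)) a := by
  induction j generalizing a with
  | zero => rfl
  | succ j ih => simp only [Term.tuple, Term.Names, IsTuple, ih, exists_and_left, exists_eq_left]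

theorem exists_snoc_iff {α : Type w} {n : ℕ} {A : α → Prop} {p : (Fin (n + 1) → α) → Prop} :
    (∃ x : Fin (n + 1) → α, (∀ i, A (x i)) ∧ p x) ↔
      ∃ x : Fin n → α, (∀ i, A (x i)) ∧ ∃ a, A a ∧ p (Fin.snoc x a) := by
  constructor
  · rintro ⟨x, hx, hp⟩
    refine ⟨Fin.init x, fun i => hx _, x (Fin.last n), hx _, ?_⟩
    rwa [Fin.snoc_init_self]
  · rintro ⟨x, hx, a, ha, hp⟩
    refine ⟨Fin.snoc x a, fun i => ?_, hp⟩
    refine Fin.lastCases ?_ (fun j => ?_) i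
    · simpa using ha
    · simpa using hx j

theorem snoc_elim0 {α : Type w} (a : α) : (Fin.snoc Fin.elim0 a : Fin 1 → α) = fun _ => a :=
  funext fun i => by
    rw [(Subsingleton.elim (α := Fin 1) i (Fin.last 0) : i = Fin.last 0)]
    exact Fin.snoc_last (α := fun _ => α) a Fin.elim0

theorem Formula.holds_bounded_ex {n : ℕ} (A : Superstructure X)
    (φ : Formula (Superstructure X) (n + 1)) (v : Fin n → Superstructure X) :
    (Formula.bounded .ex (.const A) φ).Holds v ↔ ∃ a ∈ A, φ.Holds (Fin.snoc v a) := by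
  simp only [Formula.Holds, Term.Names, exists_eq_left]

theorem Formula.holds_bounded_all {n : ℕ} (A : Superstructure X)
    (φ : Formula (Superstructure X) (n + 1)) (v : Fin n → Superstructure X) :
    (Formula.bounded .all (.const A) φ).Holds v ↔ ∀ a ∈ A, φ.Holds (Fin.snoc v a) := by
  simp only [Formula.Holds, Term.Names, forall_eq]

theorem Formula.isTrue_existsIn {n : ℕ} (A : Superstructure X)
    (φ : Formula (Superstructure X) n) :
    (φ.existsIn A).IsTrue ↔ ∃ x : Fin n → Superstructure X, (∀ i, x i ∈ A) ∧ φ.Holds x := by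
  induction n with
  | zero =>
    refine ⟨fun h => ⟨Fin.elim0, fun i => i.elim0, h⟩, fun ⟨x, _, h⟩ => ?_⟩
    rwa [Subsingleton.elim x Fin.elim0] at h
  | succ n ih =>
    rw [exists_snoc_iff (A := fun a => a ∈ A)]
    simp only [← Formula.holds_bounded_ex]
    exact ih _

/-- Lets a formula with free variables say "there is a tuple from `A`", by using `constrain` with
all quantifiers existential and one common bound. -/
theorem Formula.holds_constrain_ex {n m : ℕ} (A : Superstructure X)
    (φ : Formula (Superstructure X) (n + m)) (v : Fin n → Superstructure X) :
    (φ.constrain (fun _ => .ex) (fun _ => A)).Holds v ↔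
      ∃ x : Fin m → Superstructure X, (∀ i, x i ∈ A) ∧ φ.Holds (Fin.append v x) := by
  induction m with
  | zero =>
    have h : ∀ x : Fin 0 → Superstructure X, Fin.append v x = v := fun x => by
      rw [Subsingleton.elim x Fin.elim0, Fin.append_elim0]; rfl
    simp only [h]
    exact ⟨fun h => ⟨Fin.elim0, fun i => i.elim0, h⟩, fun ⟨_, _, h⟩ => h⟩
  | succ m ih =>
    rw [exists_snoc_iff (A := fun a => a ∈ A)]
    simp only [Fin.append_snoc, ← Formula.holds_bounded_ex]
    exact ih _

theorem ModelsExistentialClosure.mono {n m : ℕ} {A B : Superstructure X}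
    (h : ∀ y ∈ A, y ∈ B) {Q : Fin m → Quantifier} {S : Fin m → Superstructure X}
    {φ : Formula (Superstructure X) (n + m)} (hA : ModelsExistentialClosure A Q S φ) :
    ModelsExistentialClosure B Q S φ := by
  obtain ⟨x, hx, hφ⟩ := (Formula.isTrue_existsIn _ _).1 hA
  exact (Formula.isTrue_existsIn _ _).2 ⟨x, fun i => h _ (hx i), hφ⟩

end Formulas

/-! ### Consequences of transfer -/

namespace SuperstructureModel

variable {X : ZFSet.{u}} {X' : ZFSet.{v}} (M : SuperstructureModel X X')

theorem transfer_existsIn {n : ℕ} (A : Superstructure X) (φ : Formula (Superstructure X) n) :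
    (∃ x : Fin n → Superstructure X, (∀ i, x i ∈ A) ∧ φ.Holds x) ↔
      ∃ x : Fin n → Superstructure X', (∀ i, x i ∈ M.star A) ∧ (φ.map M.star).Holds x := by
  rw [← Formula.isTrue_existsIn, M.transfer, Formula.map_existsIn, Formula.isTrue_existsIn]

theorem transfer_forall {A : Superstructure X} {φ : Formula (Superstructure X) 1} :
    (∀ a ∈ A, φ.Holds fun _ => a) ↔ ∀ a ∈ M.star A, (φ.map M.star).Holds fun _ => a := by
  have h := M.transfer (.bounded .all (.const A) φ)
  simp only [Formula.IsTrue, Formula.map, Term.map, Formula.holds_bounded_all] at h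
  simpa only [snoc_elim0] using h

theorem holds_mem_const {Z : ZFSet.{u}} (a A : Superstructure Z) :
    (Formula.mem (.var 0) (.const A) : Formula (Superstructure Z) 1).Holds (fun _ => a) ↔
      a ∈ A := by
  simp [Formula.Holds, Term.Names]

/-- With `star_or` and `star_not`, this is the Boolean part of transfer that makes the sets `A` with
`α ∈ *A` an ultrafilter. -/
theorem star_imp {A B C : Superstructure X} (h : ∀ a ∈ A, a ∈ B → a ∈ C) :
    ∀ a ∈ M.star A, a ∈ M.star B → a ∈ M.star C := by
  have := (M.transfer_forall (A := A) (φ := .imp (.mem (.var 0) (.const B))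
    (.mem (.var 0) (.const C)))).1
  simp only [Formula.map, Term.map, Formula.Holds.eq_6, holds_mem_const] at this
  exact this h

theorem star_or {A B C : Superstructure X} (h : ∀ a ∈ A, a ∈ B ∨ a ∈ C) :
    ∀ a ∈ M.star A, a ∈ M.star B ∨ a ∈ M.star C := by
  have := (M.transfer_forall (A := A) (φ := .or (.mem (.var 0) (.const B))
    (.mem (.var 0) (.const C)))).1
  simp only [Formula.map, Term.map, Formula.Holds.eq_5, holds_mem_const] at this
  exact this h

theorem star_not {A B : Superstructure X} (h : ∀ a ∈ A, a ∉ B) :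
    ∀ a ∈ M.star A, a ∉ M.star B := by
  have := (M.transfer_forall (A := A) (φ := .neg (.mem (.var 0) (.const B)))).1
  simp only [Formula.map, Term.map, Formula.Holds.eq_3, holds_mem_const] at this
  exact this h

theorem star_mono {A B : Superstructure X} (h : ∀ a ∈ A, a ∈ B) :
    ∀ a ∈ M.star A, a ∈ M.star B :=
  fun a ha => M.star_imp (fun a ha _ => h a ha) a ha ha

/-- The ultrafilter on `Y` generated by a point of `*Y`. -/
noncomputable def ultrafilter {Y : Superstructure X} {α : Superstructure X'}
    (hα : α ∈ M.star Y) : Ultrafilter Y.Elem :=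
  Ultrafilter.ofComplNotMemIff
    { sets := {S | α ∈ M.star (M.isBaseSet.subset S)}
      univ_sets := M.star_mono (fun _ h => M.isBaseSet.mem_subset_iff.2 ⟨h, Set.mem_univ _⟩) α hα
      sets_of_superset := fun {_ _} hS h => M.star_mono (fun _ hy =>
        have ⟨hY, hS⟩ := M.isBaseSet.mem_subset_iff.1 hy
        M.isBaseSet.mem_subset_iff.2 ⟨hY, h hS⟩) α hS
      inter_sets := fun {_ _} hS hT => M.star_imp (fun _ hy hy' =>
        have ⟨hY, hS⟩ := M.isBaseSet.mem_subset_iff.1 hy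
        have ⟨_, hT⟩ := M.isBaseSet.mem_subset_iff.1 hy'
        M.isBaseSet.mem_subset_iff.2 ⟨hY, hS, hT⟩) α hS hT }
    fun S => ⟨fun h => (M.star_or (fun y hy => by
        simp only [M.isBaseSet.mem_subset_iff, hy, exists_true_left]
        exact em _) α hα).resolve_right h,
      fun hS => M.star_not (fun _ hy hy' =>
        have ⟨_, hS⟩ := M.isBaseSet.mem_subset_iff.1 hy
        have ⟨_, hT⟩ := M.isBaseSet.mem_subset_iff.1 hy'
        hT hS) α hS⟩

theorem star_mem_of_ultrafilterContains {Y A : Superstructure X} {α : Superstructure X'}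
    (hα : α ∈ M.star Y) (hA : UltrafilterContains (M.ultrafilter hα) A) : α ∈ M.star A :=
  M.star_mono (fun _ hy => (M.isBaseSet.mem_subset_iff.1 hy).2) α hA.2

/-- Maximality of `U`: if `A ∉ U`, the complement of `A` is in `U`, and `α` cannot lie in the stars
of two disjoint sets. -/
theorem generated_eq_of_forall_mem {Y : Superstructure X} {U : Ultrafilter Y.Elem}
    {α : Superstructure X'} (h : ∀ A, UltrafilterContains U A → α ∈ M.star A) :
    M.generated Y α = {A | UltrafilterContains U A} := by
  ext A
  refine ⟨fun hA => ⟨hA.1, ?_⟩, fun hA => ⟨hA.1, h A hA⟩⟩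
  by_contra hU
  have hc := Ultrafilter.compl_mem_iff_notMem.2 hU
  refine M.star_not (fun y hy hy' => ?_) α hA.2 (h (M.isBaseSet.subset {y | y.1 ∈ A}ᶜ)
    (M.isBaseSet.ultrafilterContains_subset hc))
  exact (M.isBaseSet.mem_subset_iff.1 hy').2 hy

/-- By enlargement, the points of `*Y` that generate the ultrafilter `U` can be chosen so as to
satisfy `*ψ`, if `ψ` is satisfied in every member of `U`. -/
theorem exists_generators {Y : Superstructure X} (hM : M.IsEnlarging (Order.succ #(Set Y.Elem)))
    {n : ℕ} (ψ : Formula (Superstructure X) n) (U : Ultrafilter Y.Elem)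
    (h : ∀ A, UltrafilterContains U A →
      ∃ x : Fin n → Superstructure X, (∀ i, x i ∈ A) ∧ ψ.Holds x) :
    ∃ α : Fin n → Superstructure X', (∀ i, ∀ A, UltrafilterContains U A → α i ∈ M.star A) ∧
      (ψ.map M.star).Holds α := by
  have hX := M.isBaseSet
  obtain ⟨N, hN⟩ := hX.exists_level_of_mem Y
  obtain ⟨K, hK⟩ := exists_isTuple Y N n
  -- `B S` is the set of codes of tuples from `S` that satisfy `ψ`.
  choose B hBset hB using fun S : Set Y.Elem => hX.exists_isSet K fun a =>
    ∃ x : Fin n → Superstructure X, (∀ i, x i ∈ hX.subset S) ∧ IsTuple Y x a ∧ ψ.Holds x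
  obtain ⟨ξ, hξ⟩ : ∃ ξ : Superstructure X', ∀ A ∈ B '' {S | S ∈ U}, ξ ∈ M.star A := by
    refine hM _ ?_ ?_ fun G hG hfin => ?_
    · rintro _ ⟨S, -, rfl⟩
      exact hBset S
    · exact Order.lt_succ_of_le (Cardinal.mk_image_le.trans (Cardinal.mk_set_le _))
    -- A solution inside the intersection of finitely many members of `U` has its code in each
    -- corresponding `B S`.
    · obtain ⟨T, hT, hTfin, rfl⟩ := Set.exists_subset_image_finite_and.1 ⟨G, hG, hfin, rfl⟩
      have hI : ⋂₀ T ∈ U := (Filter.sInter_mem hTfin).2 hT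
      obtain ⟨x, hx, hψ⟩ := h _ (hX.ultrafilterContains_subset hI)
      obtain ⟨a, ha, haK⟩ := hK x fun i => hN _ ((hX.subset_isSubset _).2 _ (hx i))
      refine ⟨a, ?_⟩
      rintro _ ⟨S, hS, rfl⟩
      refine (hB S a).2 ⟨haK, x, fun i => ?_, ha, hψ⟩
      obtain ⟨hY, hT⟩ := hX.mem_subset_iff.1 (hx i)
      exact hX.mem_subset_iff.2 ⟨hY, hT S hS⟩
  have htuple : ∀ S ∈ U, ∃ x : Fin n → Superstructure X', (∀ i, x i ∈ M.star (hX.subset S)) ∧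
      IsTuple (M.star Y) x ξ := fun S hS => by
    -- Variable 0 is the code; the other `n` variables, bound by existential quantifiers over `S`,
    -- are its components.
    have key := (M.transfer_forall (A := B S)
      (φ := (Formula.eq (.var (Fin.castAdd n 0)) (Term.tuple Y (Fin.natAdd 1))).constrain
        (fun _ => .ex) (fun _ => hX.subset S))).1
    simp only [Formula.map_constrain, Formula.map, Term.map, Term.map_tuple,
      Formula.holds_constrain_ex, Formula.Holds, Term.Names, Term.names_tuple, Fin.append_left,
      Fin.append_right, exists_eq_left] at key
    exact key (fun a ha => ((hB S a).1 ha).2.imp fun x hx => ⟨hx.1, hx.2.1⟩) ξ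
      (hξ _ ⟨S, hS, rfl⟩)
  -- The components are fixed using `S = univ`; injectivity of coding then places them in every
  -- `*S`.
  obtain ⟨α, hα, hαξ⟩ := htuple Set.univ Filter.univ_mem
  refine ⟨α, fun i A hA => ?_, ?_⟩
  · obtain ⟨x, hx, hxξ⟩ := htuple _ hA.2
    rw [hαξ.inj hxξ]
    exact M.star_mono (fun _ hy => (hX.mem_subset_iff.1 hy).2) _ (hx i)
  -- `ψ` is transferred separately, in its own variables, which avoids renaming: a failure of `*ψ`
  -- at `α` would descend to a code in `B univ` of a tuple violating `ψ`.
  · by_contra hn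
    have key := (M.transfer_existsIn (hX.subset (Set.univ : Set Y.Elem))
      (.and (.mem (Term.tuple Y id) (.const (B Set.univ))) (.neg ψ))).2
    simp only [Formula.map, Term.map, Term.map_tuple, Formula.Holds, Term.names_tuple,
      Term.Names, id_eq] at key
    obtain ⟨x, -, ⟨a, _, ha, rfl, haB⟩, hx⟩ :=
      key ⟨α, hα, ⟨ξ, _, hαξ, rfl, hξ _ ⟨_, Filter.univ_mem, rfl⟩⟩, hn⟩
    obtain ⟨-, x', -, hx', hψ⟩ := (hB _ a).1 haB
    obtain rfl : x = x' := ha.inj hx'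
    exact hx hψ

end SuperstructureModel

/-! ### Partition regularity and ultrafilters -/

section PartitionRegular

variable {X : ZFSet.{u}} {n m : ℕ} {Y : Superstructure X} {Q : Fin m → Quantifier}
  {S : Fin m → Superstructure X} {φ : Formula (Superstructure X) (n + m)}

theorem IsPartitionRegular.exists_ultrafilter (hX : IsBaseSet X)
    (h : IsPartitionRegular Y Q S φ) :
    ∃ U : Ultrafilter Y.Elem, ∀ A, UltrafilterContains U A →
      ModelsExistentialClosure A Q S φ := by
  let F : Set (Set Y.Elem) := {T | ¬ ModelsExistentialClosure (hX.subset Tᶜ) Q S φ}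
  have hF : (Filter.generate F).NeBot := by
    refine Filter.generate_neBot_iff.2 fun t ht hfin => ?_
    by_contra hne
    obtain ⟨k, f, hf⟩ := hfin.fin_param
    have hcover : ∀ y, ∃ i, y ∉ f i := fun y => by
      by_contra! hy
      refine hne ⟨y, fun T hT => ?_⟩
      rw [← hf.2] at hT
      obtain ⟨i, rfl⟩ := hT
      exact hy i
    -- The complements of the `f i` cover `Y`; assigning each `y` to the first `i` with `y ∉ f i`
    -- makes them disjoint.
    obtain ⟨i, hi⟩ := h k (fun i => hX.subset {y | y ∉ f i ∧ ∀ j < i, y ∈ f j})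
      ⟨fun i => hX.subset_isSubset _, fun y hy => by
        obtain ⟨i, hi, hmin⟩ := exists_minimal_of_wellFoundedLT _ (hcover ⟨y, hy⟩)
        exact ⟨i, hX.mem_subset_iff.2 ⟨hy, hi, fun j hj => by_contra fun hj' =>
          (hmin hj' hj.le).not_gt hj⟩⟩, fun i j hij y hy hy' => by
        obtain ⟨_, hi, hi'⟩ := hX.mem_subset_iff.1 hy
        obtain ⟨_, hj, hj'⟩ := hX.mem_subset_iff.1 hy'
        rcases hij.lt_or_gt with hlt | hlt
        · exact hi (hj' _ hlt)
        · exact hj (hi' _ hlt)⟩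
    -- The piece that models `E` lies inside the complement of `f i`, which is bad because `f i ∈
    -- F`.
    refine ht (hf.2 ▸ ⟨i, rfl⟩ : f i ∈ t) (hi.mono fun y hy => ?_)
    obtain ⟨hY, hy, -⟩ := hX.mem_subset_iff.1 hy
    exact hX.mem_subset_iff.2 ⟨hY, hy⟩
  refine ⟨Ultrafilter.of (Filter.generate F), fun A hA => ?_⟩
  by_contra hn
  have hc : {y : Y.Elem | y.1 ∈ A}ᶜ ∈ F := fun hm => hn (hm.mono fun y hy => by
    rw [compl_compl] at hy
    exact (hX.mem_subset_iff.1 hy).2)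
  exact Ultrafilter.compl_mem_iff_notMem.1
    (Ultrafilter.of_le _ (Filter.GenerateSets.basic hc)) hA.2

theorem isPartitionRegular_of_ultrafilter (U : Ultrafilter Y.Elem)
    (h : ∀ A, UltrafilterContains U A → ModelsExistentialClosure A Q S φ) :
    IsPartitionRegular Y Q S φ := fun k A hA => by
  have hU : (⋃ i, {y : Y.Elem | y.1 ∈ A i}) ∈ U :=
    Filter.mem_of_superset Filter.univ_mem fun y _ => Set.mem_iUnion.2 (hA.2.1 y.1 y.2)
  obtain ⟨i, hi⟩ := Ultrafilter.eventually_exists_iff.1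
    (Filter.mem_of_superset hU fun y hy => Set.mem_iUnion.1 hy)
  exact ⟨i, h _ ⟨hA.1 i, hi⟩⟩

end PartitionRegular

end Nonstandard

/-! ### The three-way equivalence -/

theorem mainTheorem1 {X : ZFSet.{u}} {X' : ZFSet.{v}}
    (M : Nonstandard.SuperstructureModel X X')
    (Y : Nonstandard.Superstructure X) (hY : Y.IsSet)
    (hM : M.IsEnlarging (Order.succ #(Set Y.Elem)))
    (n m : ℕ) (hn : 1 ≤ n)
    (φ : Nonstandard.Formula (Nonstandard.Superstructure X) (n + m)) (hφ : φ.IsTotallyOpen)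
    (Q : Fin m → Nonstandard.Quantifier)
    (S : Fin m → Nonstandard.Superstructure X) (hS : ∀ i, (S i).IsSet) :
    List.TFAE [
      Nonstandard.IsPartitionRegular Y Q S φ,
      ∃ α : Fin n → Nonstandard.Superstructure X',
        (∀ i, α i ∈ M.star Y) ∧ (∀ i j, M.Equivalent Y (α i) (α j)) ∧
          ((φ.map M.star).constrain Q (fun i => M.star (S i))).Holds α,
      ∃ U : Ultrafilter Y.Elem, ∀ A : Nonstandard.Superstructure X,
        Nonstandard.UltrafilterContains U A → Nonstandard.ModelsExistentialClosure A Q S φ] := by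
  have hX := M.isBaseSet
  tfae_have 1 → 3 := fun h => h.exists_ultrafilter hX
  tfae_have 3 → 1 := fun ⟨U, h⟩ => Nonstandard.isPartitionRegular_of_ultrafilter U h
  tfae_have 3 → 2 := by
    rintro ⟨U, h⟩
    obtain ⟨α, hα, hψ⟩ := M.exists_generators hM (φ.constrain Q S) U
      fun A hA => (Nonstandard.Formula.isTrue_existsIn _ _).1 (h A hA)
    have hαY : ∀ i, α i ∈ M.star Y := fun i =>
      hα i Y ⟨⟨hY, fun _ h => h⟩, Filter.mem_of_superset Filter.univ_mem fun y _ => y.2⟩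
    refine ⟨α, hαY, fun i j => ⟨hαY i, hαY j, ?_⟩, ?_⟩
    · rw [M.generated_eq_of_forall_mem (hα i), M.generated_eq_of_forall_mem (hα j)]
    · rwa [Nonstandard.Formula.map_constrain] at hψ
  tfae_have 2 → 3 := by
    rintro ⟨α, hαY, hα, hψ⟩
    -- Since `n ≥ 1` there is a first point; equivalence carries membership in `*A` from it to all
    -- the others.
    refine ⟨M.ultrafilter (hαY ⟨0, hn⟩), fun A hA => ?_⟩
    have hmem : ∀ i, α i ∈ M.star A := fun i =>
      ((hα ⟨0, hn⟩ i).2.2 ▸ (⟨hA.1, M.star_mem_of_ultrafilterContains _ hA⟩ :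
        A ∈ M.generated Y (α ⟨0, hn⟩)) : A ∈ M.generated Y (α i)).2
    refine (Nonstandard.Formula.isTrue_existsIn _ _).2 ((M.transfer_existsIn A _).2 ⟨α, hmem, ?_⟩)
    rwa [Nonstandard.Formula.map_constrain]
  tfae_finish
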